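/- For a real matrix $B$ with finitely many rows $B_i\in\mathbb R^n$, $i\in I$, and $c\in\mathbb R^{I}$, let $\mathrm{Sig}(c,B)$ denote the signomial $\mathrm{Sig}(c,B)(x)=\sum_{i\in I}c_i\exp(B_i x)$ on $\mathbb R^n$. For $X\subseteq\mathbb R^n$ and $i\in I$ let $$\mathrm{AGE}(B,X,i)=\{\mathrm{Sig}(c,B):\ c_j\ge 0\text{ for all }j\ne i,\ \mathrm{Sig}(c,B)(x)\ge 0\text{ for all }x\in X\},$$ and let $\mathrm{SAGE}(B,X)=\sum_{i\in I}\mathrm{AGE}(B,X,i)$ (Minkowski sum of sets of functions on $\mathbb R^n$). For a matrix $A\in\mathbb R^{\ell\times n}$ with rows $A_1,\dots,A_\ell$ and an integer $p\ge 0$, let $E_p(A)$ be the matrix whose rows are the elements of the finite set $$\Big\{\sum_{i=1}^{\ell}w_iA_i:\ w_i\in\mathbb Z,\ w_i\ge 0,\ \sum_{i=1}^{\ell}w_i\le p\Big\},$$ and let $$C^{(p)}_{\mathrm{SAGE}}(A,X)=\Big\{c\in\mathbb R^\ell:\ \Big(\sum_{j=1}^\ell\exp(A_jx)\Big)^{p}\,\mathrm{Sig}(c,A)\in\mathrm{SAGE}(E_{p+1}(A),X)\Big\}.$$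 **Theorem.** Let $A\in\mathbb Q^{\ell\times n}$ and let $X\subset\mathbb R^n$ be a compact convex set. If $c\in\mathbb R^\ell$ and $\mathrm{Sig}(c,A)(x)>0$ for all $x\in X$, then there is an integer $p\ge 0$ such that $$\Big(\sum_{j=1}^\ell\exp(A_jx)\Big)^{p}\,\mathrm{Sig}(c,A)\in\mathrm{SAGE}(E_{p+1}(A),X).$$ Consequently the conditional SAGE hierarchy is complete, in the sense that every $c$ for which $\mathrm{Sig}(c,A)$ is strictly positive on $X$ lies in some finite level: $$\{c\in\mathbb R^\ell:\ \mathrm{Sig}(c,A)(x)>0\ \ \forall x\in X\}\subseteq\bigcup_{p\ge 0}C^{(p)}_{\mathrm{SAGE}}(A,X).$$ -/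

import Mathlib

open scoped Pointwise

namespace SageHierarchy

/-- The signomial `Sig(c, A)(x) = ∑ j, c j * exp (A_j x)`, where `A_j` is the `j`-th row of the
exponent matrix `A`. -/
noncomputable def Sig {ι : Type*} [Fintype ι] {n : ℕ} (c : ι → ℝ) (A : Matrix ι (Fin n) ℝ) :
    (Fin n → ℝ) → ℝ :=
  fun x => ∑ j, c j * Real.exp (A.mulVec x j)

/-- The positive multiplier `exp(A x)ᵀ 1 = ∑ j, exp (A_j x)`. -/
noncomputable def expSum {ι : Type*} [Fintype ι] {n : ℕ} (A : Matrix ι (Fin n) ℝ) :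
    (Fin n → ℝ) → ℝ :=
  fun x => ∑ j, Real.exp (A.mulVec x j)

/-- Conditional AGE signomials: those `Sig(c, A)` that are nonnegative on `X` and whose
coefficients are nonnegative except possibly at the index `i`. -/
def AGE {ι : Type*} [Fintype ι] {n : ℕ} (A : Matrix ι (Fin n) ℝ) (X : Set (Fin n → ℝ)) (i : ι) :
    Set ((Fin n → ℝ) → ℝ) :=
  {f | ∃ c : ι → ℝ, f = Sig c A ∧ (∀ j, j ≠ i → 0 ≤ c j) ∧ ∀ x ∈ X, 0 ≤ Sig c A x}

/-- Conditional SAGE signomials: the Minkowski sum of the sets `AGE(A, X, i)` over all `i`. -/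
noncomputable def SAGE {ι : Type*} [Fintype ι] {n : ℕ} (A : Matrix ι (Fin n) ℝ)
    (X : Set (Fin n → ℝ)) : Set ((Fin n → ℝ) → ℝ) :=
  ∑ i, AGE A X i

/-- All combinations of the rows of `A` with nonnegative integer weights of sum at most `p`. -/
def rowCombinations {ℓ n : ℕ} (p : ℕ) (A : Matrix (Fin ℓ) (Fin n) ℝ) : Set (Fin n → ℝ) :=
  {a | ∃ w : Fin ℓ → ℕ, ∑ i, w i ≤ p ∧ a = ∑ i, (w i : ℝ) • A i}

theorem rowCombinations_finite {ℓ n : ℕ} (p : ℕ) (A : Matrix (Fin ℓ) (Fin n) ℝ) :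
    (rowCombinations p A).Finite := by
  refine ((Set.finite_Iic (fun _ : Fin ℓ => p)).image
    (fun w => ∑ i, (w i : ℝ) • A i)).subset ?_
  rintro a ⟨w, hw, rfl⟩
  exact ⟨w, fun i => (Finset.single_le_sum (fun j _ => Nat.zero_le (w j))
    (Finset.mem_univ i)).trans hw, rfl⟩

noncomputable instance {ℓ n : ℕ} (p : ℕ) (A : Matrix (Fin ℓ) (Fin n) ℝ) :
    Fintype (rowCombinations p A) :=
  (rowCombinations_finite p A).fintype

/-- The matrix `E_p(A)`, whose rows are the elements of `rowCombinations p A`. -/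
def E {ℓ n : ℕ} (p : ℕ) (A : Matrix (Fin ℓ) (Fin n) ℝ) :
    Matrix (rowCombinations p A) (Fin n) ℝ :=
  Matrix.of fun a => (a : Fin n → ℝ)

/-- The `p`-th level `C_SAGE^(p)(A, X)` of the hierarchy of conditional SAGE cones. -/
def CSAGE {ℓ n : ℕ} (p : ℕ) (A : Matrix (Fin ℓ) (Fin n) ℝ) (X : Set (Fin n → ℝ)) :
    Set (Fin ℓ → ℝ) :=
  {c | expSum A ^ p * Sig c A ∈ SAGE (E (p + 1) A) X}

end SageHierarchy

/-! With `y = exp (A x)` the claim concerns the linear form `c·y` on `Y = exp (A X)`. Call a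
homogeneous binomial `g = s y^a - r y^b` with `s ≥ 0` and `g ≥ 0` on `Y` valid; multiplying it by a
monomial with nonnegative coefficient gives an AGE signomial.

If `u` lies in the simplex and `c·u ≤ 0`, some valid `g` is negative at `u`: for positive `u`,
separate `log u` from `A X` modulo constant vectors (`exists_isValid_eval_neg_of_pos`). By
compactness finitely many valid `g` satisfy `c·u + ∑ g⁻(u)² > 0` on the whole simplex, where `g⁻ =
max 0 (-g)`. Since `g⁻ g = -(g⁻)²`, this positive function is `c·u - ∑ g⁻ g`.

Now replace each factor `g⁻` by its Bernstein form of degree `p + 1 - deg g`, which has nonnegative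
coefficients, and subtract the products with `g` from `(∑ y)^p (c·y)`. As in Pólya's theorem, the
remaining coefficients, divided by multinomials, approach the positive function at `w / (p + 1)`, so
all are nonnegative for some `p` (`exists_coeff_nonneg`). -/

open Filter Topology Finset

namespace SageHierarchy

/-! ### SAGE signomials as a cone -/

section Cone

variable {ι : Type*} [Fintype ι] {n : ℕ} {A : Matrix ι (Fin n) ℝ} {X : Set (Fin n → ℝ)}

theorem zero_mem_AGE (i : ι) : (0 : (Fin n → ℝ) → ℝ) ∈ AGE A X i :=
  ⟨0, by ext x; simp [Sig], fun _ _ => le_rfl, fun x _ => by simp [Sig]⟩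

theorem Sig_add (c d : ι → ℝ) : Sig (c + d) A = Sig c A + Sig d A := by
  ext x; simp [Sig, add_mul, Finset.sum_add_distrib]

theorem add_mem_AGE {i : ι} {f g : (Fin n → ℝ) → ℝ} (hf : f ∈ AGE A X i) (hg : g ∈ AGE A X i) :
    f + g ∈ AGE A X i := by
  obtain ⟨c, rfl, hc, hc'⟩ := hf
  obtain ⟨d, rfl, hd, hd'⟩ := hg
  refine ⟨c + d, (Sig_add c d).symm, fun j hj => add_nonneg (hc j hj) (hd j hj), fun x hx => ?_⟩
  rw [Sig_add]
  exact add_nonneg (hc' x hx) (hd' x hx)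

theorem AGE_subset_SAGE (i : ι) : AGE A X i ⊆ SAGE A X := by
  classical
  intro f hf
  rw [SAGE, Set.mem_fintype_sum]
  refine ⟨Pi.single i f, fun j => ?_, by simp⟩
  by_cases h : j = i
  · subst h; simpa using hf
  · simpa [h] using zero_mem_AGE j

theorem zero_mem_SAGE : (0 : (Fin n → ℝ) → ℝ) ∈ SAGE A X := by
  rw [SAGE, Set.mem_fintype_sum]
  exact ⟨0, fun j => zero_mem_AGE j, by simp⟩

theorem add_mem_SAGE {f g : (Fin n → ℝ) → ℝ} (hf : f ∈ SAGE A X) (hg : g ∈ SAGE A X) :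
    f + g ∈ SAGE A X := by
  rw [SAGE, Set.mem_fintype_sum] at *
  obtain ⟨F, hF, rfl⟩ := hf
  obtain ⟨G, hG, rfl⟩ := hg
  exact ⟨F + G, fun j => add_mem_AGE (hF j) (hG j), by simp [Finset.sum_add_distrib]⟩

theorem sum_mem_SAGE {κ : Type*} (s : Finset κ) {f : κ → (Fin n → ℝ) → ℝ}
    (h : ∀ k ∈ s, f k ∈ SAGE A X) : ∑ k ∈ s, f k ∈ SAGE A X :=
  Finset.sum_induction f (· ∈ SAGE A X) (fun _ _ => add_mem_SAGE) zero_mem_SAGE h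

/-- Only index `i` can carry a negative coefficient, also when `i = j`. -/
theorem binomial_mem_SAGE (i j : ι) {s r : ℝ} (hs : 0 ≤ s)
    (h : ∀ x ∈ X, 0 ≤ s * Real.exp (A.mulVec x j) - r * Real.exp (A.mulVec x i)) :
    (fun x => s * Real.exp (A.mulVec x j) - r * Real.exp (A.mulVec x i)) ∈ SAGE A X := by
  classical
  have key : Sig (Pi.single j s - Pi.single i r) A =
      fun x => s * Real.exp (A.mulVec x j) - r * Real.exp (A.mulVec x i) := by
    ext x
    simp [Sig, sub_mul, Finset.sum_sub_distrib, Pi.single_apply]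
  refine AGE_subset_SAGE i ⟨Pi.single j s - Pi.single i r, key.symm, fun k hk => ?_, ?_⟩
  · simp only [Pi.sub_apply, Pi.single_apply, hk, if_false, sub_zero]
    split_ifs <;> simp [hs]
  · rw [key]; exact h

end Cone

/-! ### Monomials in `exp (A x)` -/

section Rows

variable {ℓ n : ℕ} {A : Matrix (Fin ℓ) (Fin n) ℝ} {X : Set (Fin n → ℝ)}

/-- Different weights may give the same row; working with `w` allows polynomial algebra in `y`. -/
theorem exists_exp_row_eq {p : ℕ} {w : Fin ℓ → ℕ} (hw : ∑ i, w i ≤ p) :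
    ∃ a : rowCombinations p A, ∀ x,
      Real.exp ((E p A).mulVec x a) = ∏ i, Real.exp (A.mulVec x i) ^ w i := by
  refine ⟨⟨∑ i, (w i : ℝ) • A i, w, hw, rfl⟩, fun x => ?_⟩
  simp_rw [← Real.exp_nat_mul, ← Real.exp_sum]
  congr 1
  simp only [Matrix.mulVec, E, Matrix.of_apply]
  rw [sum_dotProduct]
  simp [smul_dotProduct]

theorem monomial_binomial_mem_SAGE {p : ℕ} {v w : Fin ℓ → ℕ} (hv : ∑ i, v i ≤ p)
    (hw : ∑ i, w i ≤ p) {s r : ℝ} (hs : 0 ≤ s)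
    (h : ∀ x ∈ X, 0 ≤ s * ∏ i, Real.exp (A.mulVec x i) ^ v i
      - r * ∏ i, Real.exp (A.mulVec x i) ^ w i) :
    (fun x => s * ∏ i, Real.exp (A.mulVec x i) ^ v i
      - r * ∏ i, Real.exp (A.mulVec x i) ^ w i) ∈ SAGE (E p A) X := by
  obtain ⟨a, ha⟩ := exists_exp_row_eq (A := A) hv
  obtain ⟨b, hb⟩ := exists_exp_row_eq (A := A) hw
  simp_rw [← ha, ← hb] at h ⊢
  exact binomial_mem_SAGE b a hs h

theorem monomial_mem_SAGE {p : ℕ} {v : Fin ℓ → ℕ} (hv : ∑ i, v i ≤ p) {s : ℝ} (hs : 0 ≤ s) :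
    (fun x => s * ∏ i, Real.exp (A.mulVec x i) ^ v i) ∈ SAGE (E p A) X := by
  have := monomial_binomial_mem_SAGE (A := A) (X := X) (r := 0) hv hv hs
    (fun x _ => by simp only [zero_mul, sub_zero]; positivity)
  simpa using this

end Rows

/-! ### Forms in the multinomial basis -/

section Bernstein

variable {ι : Type*} [Fintype ι]

/-- Both sides equal `(∑ (v + α))! / ∏ (v i)!`. -/
theorem multinomial_add_mul_prod_descFactorial (v α : ι → ℕ) :
    (Nat.multinomial univ (v + α)) * ∏ i, ((v + α) i).descFactorial (α i) =
      Nat.multinomial univ v * (∑ i, (v + α) i).descFactorial (∑ i, α i) := by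
  have h1 := Nat.multinomial_spec univ (v + α)
  have h2 := Nat.multinomial_spec univ v
  have h3 : ∏ i, ((v + α) i).factorial =
      (∏ i, (v i).factorial) * ∏ i, ((v + α) i).descFactorial (α i) := by
    rw [← Finset.prod_mul_distrib]
    refine Finset.prod_congr rfl fun i _ => ?_
    rw [← Nat.factorial_mul_descFactorial (n := (v + α) i) (k := α i) (by simp)]
    simp
  have h4 : (∑ i, (v + α) i).factorial =
      (∑ i, v i).factorial * (∑ i, (v + α) i).descFactorial (∑ i, α i) := by
    have hs : ∑ i, (v + α) i = ∑ i, v i + ∑ i, α i := by simp [Finset.sum_add_distrib]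
    rw [← Nat.factorial_mul_descFactorial (n := ∑ i, (v + α) i) (k := ∑ i, α i) (by omega)]
    congr 2
    omega
  rw [h4, h3, ← h2] at h1
  have hpos : 0 < ∏ i, (v i).factorial := Finset.prod_pos fun i _ => Nat.factorial_pos _
  refine Nat.eq_of_mul_eq_mul_left hpos ?_
  linarith

variable [DecidableEq ι]

/-- Multiplying a form written in the multinomial basis by a monomial. -/
theorem sum_multinomial_mul_monomial {P d : ℕ} (hd : d ≤ P) {α : ι → ℕ} (hα : ∑ i, α i = d)
    (H : (ι → ℕ) → ℝ) (y : ι → ℝ) :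
    (∑ v ∈ piAntidiag univ (P - d), Nat.multinomial univ v * H v * ∏ i, y i ^ v i)
        * ∏ i, y i ^ α i =
      ∑ w ∈ piAntidiag univ P, Nat.multinomial univ w *
        ((∏ i, ((w i).descFactorial (α i) : ℝ)) / P.descFactorial d * H (w - α)) *
          ∏ i, y i ^ w i := by
  rw [Finset.sum_mul]
  refine Finset.sum_of_injOn (fun v => v + α) (fun _ _ _ _ h => add_right_cancel h) ?_ ?_ ?_
  · intro v hv
    simp only [Finset.mem_coe, mem_piAntidiag] at hv ⊢
    refine ⟨?_, by simp⟩
    simp only [Pi.add_apply, Finset.sum_add_distrib, hv.1, hα]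
    omega
  · intro w hw hw'
    -- Where `w - α` truncates, a falling factorial vanishes, so the junk value of `H` is harmless.
    have : ∃ i, w i < α i := by
      by_contra! hcon
      refine hw' ⟨w - α, ?_, by ext i; simp [hcon i]⟩
      simp only [Finset.mem_coe, mem_piAntidiag] at hw ⊢
      refine ⟨?_, by simp⟩
      rw [← hw.1, ← hα]
      exact Finset.sum_tsub_distrib _ fun i _ => hcon i
    obtain ⟨i, hi⟩ := this
    have h0 : ∏ i, ((w i).descFactorial (α i) : ℝ) = 0 :=
      Finset.prod_eq_zero (mem_univ i) (by exact_mod_cast Nat.descFactorial_of_lt hi)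
    simp [h0]
  · intro v hv
    simp only [mem_piAntidiag] at hv
    have hP : ∑ i, (v + α) i = P := by
      simp only [Pi.add_apply, Finset.sum_add_distrib, hv.1, hα]; omega
    have key := multinomial_add_mul_prod_descFactorial v α
    rw [hP, hα] at key
    have key' : (Nat.multinomial univ (v + α) : ℝ) *
        ∏ i, (((v + α) i).descFactorial (α i) : ℝ) =
        Nat.multinomial univ v * P.descFactorial d := by exact_mod_cast key
    have hne : (P.descFactorial d : ℝ) ≠ 0 := by
      exact_mod_cast (Nat.descFactorial_pos.2 hd).ne'
    have hy : ∏ i, y i ^ (v + α) i = (∏ i, y i ^ v i) * ∏ i, y i ^ α i := by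
      simp [pow_add, Finset.prod_mul_distrib]
    rw [hy, add_tsub_cancel_right]
    field_simp
    linear_combination (-H v * (∏ i, y i ^ v i) * ∏ i, y i ^ α i) * key'

theorem sum_pow_mul_linear (p : ℕ) (c y : ι → ℝ) :
    (∑ i, y i) ^ p * ∑ i, c i * y i =
      ∑ w ∈ piAntidiag univ (p + 1), Nat.multinomial univ w *
        (∑ i, c i * ((w i : ℝ) / ((p + 1 : ℕ) : ℝ))) * ∏ i, y i ^ w i := by
  have key : ∀ i, (∑ i, y i) ^ p * y i = ∑ w ∈ piAntidiag univ (p + 1),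
      Nat.multinomial univ w * ((w i : ℝ) / ((p + 1 : ℕ) : ℝ)) * ∏ i, y i ^ w i := by
    intro i
    have h := sum_multinomial_mul_monomial (P := p + 1) (d := 1) (by omega)
      (α := Pi.single i 1) (by simp) (fun _ => 1) y
    have e1 : ∏ j, y j ^ (Pi.single i 1 : ι → ℕ) j = y i := by
      rw [Finset.prod_eq_single i] <;> simp +contextual
    have e2 : ∀ w : ι → ℕ,
        ∏ j, ((w j).descFactorial ((Pi.single i 1 : ι → ℕ) j) : ℝ) = w i := by
      intro w
      rw [Finset.prod_eq_single i] <;> simp +contextual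
    simp only [e1, e2, mul_one, Nat.descFactorial_one, Nat.add_sub_cancel] at h
    rw [← h, Finset.sum_pow_eq_sum_piAntidiag]
  rw [Finset.mul_sum]
  simp_rw [Finset.mul_sum, Finset.sum_mul]
  rw [Finset.sum_comm]
  refine Finset.sum_congr rfl fun i _ => ?_
  rw [mul_left_comm, key i, Finset.mul_sum]
  refine Finset.sum_congr rfl fun w _ => ?_
  ring

end Bernstein

/-! ### Falling factorials are asymptotically powers -/

section Limits

variable {ι : Type*} [Fintype ι]

/-- Truncated subtraction of `a` moves the numerator by at most `a`, negligible against `P j`. -/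
theorem tendsto_tsub_div_tsub {P : ℕ → ℕ} (hP : Tendsto P atTop atTop) {w : ℕ → ℕ} {u : ℝ}
    (hw : Tendsto (fun j => (w j : ℝ) / P j) atTop (𝓝 u)) (a d : ℕ) :
    Tendsto (fun j => ((w j - a : ℕ) : ℝ) / ((P j - d : ℕ) : ℝ)) atTop (𝓝 u) := by
  have hPR : Tendsto (fun j => (P j : ℝ)) atTop atTop :=
    tendsto_natCast_atTop_atTop.comp hP
  have h1 : ∀ a : ℕ, Tendsto (fun j => (a : ℝ) / P j) atTop (𝓝 0) := fun a =>
    tendsto_const_nhds.div_atTop hPR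
  have hnum : Tendsto (fun j => ((w j - a : ℕ) : ℝ) / P j) atTop (𝓝 u) := by
    refine tendsto_of_tendsto_of_tendsto_of_le_of_le (by simpa using hw.sub (h1 a)) hw ?_ ?_
    · intro j
      simp only
      rw [← sub_div]
      gcongr
      rw [sub_le_iff_le_add]
      exact_mod_cast (show w j ≤ w j - a + a by omega)
    · intro j
      simp only
      gcongr
      omega
  have hden : Tendsto (fun j => ((P j - d : ℕ) : ℝ) / P j) atTop (𝓝 1) := by
    have : Tendsto (fun j => 1 - (d : ℝ) / P j) atTop (𝓝 1) := by
      simpa using (tendsto_const_nhds (x := (1 : ℝ))).sub (h1 d)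
    refine this.congr' ?_
    filter_upwards [hP.eventually_ge_atTop (d + 1)] with j hj
    rw [Nat.cast_sub (by omega)]
    have : (P j : ℝ) ≠ 0 := by norm_cast; omega
    field_simp
  have := hnum.div hden one_ne_zero
  rw [div_one] at this
  refine this.congr' ?_
  filter_upwards [hP.eventually_ge_atTop (d + 1)] with j hj
  have : (P j : ℝ) ≠ 0 := by norm_cast; omega
  simp only [Pi.div_apply]
  field_simp

theorem tendsto_descFactorial_div {P : ℕ → ℕ} (hP : Tendsto P atTop atTop) {w : ℕ → ℕ} {u : ℝ}
    (hw : Tendsto (fun j => (w j : ℝ) / P j) atTop (𝓝 u)) (a : ℕ) :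
    Tendsto (fun j => ((w j).descFactorial a : ℝ) / (P j : ℝ) ^ a) atTop (𝓝 (u ^ a)) := by
  induction a with
  | zero => simp
  | succ a ih =>
    have h := (tendsto_tsub_div_tsub hP hw a 0).mul ih
    rw [pow_succ']
    refine h.congr fun j => ?_
    rw [Nat.descFactorial_succ, pow_succ', Nat.cast_mul, Nat.sub_zero, div_mul_div_comm]

theorem tendsto_prod_descFactorial_div {P : ℕ → ℕ} (hP : Tendsto P atTop atTop)
    {w : ℕ → ι → ℕ} {u : ι → ℝ}
    (hw : ∀ i, Tendsto (fun j => (w j i : ℝ) / P j) atTop (𝓝 (u i))) {α : ι → ℕ} {d : ℕ}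
    (hα : ∑ i, α i = d) :
    Tendsto (fun j => (∏ i, ((w j i).descFactorial (α i) : ℝ)) / (P j).descFactorial d) atTop
      (𝓝 (∏ i, u i ^ α i)) := by
  have hden : Tendsto (fun j => ((P j).descFactorial d : ℝ) / (P j : ℝ) ^ d) atTop (𝓝 1) := by
    have h1 : Tendsto (fun j => (P j : ℝ) / P j) atTop (𝓝 1) := by
      refine tendsto_const_nhds.congr' ?_
      filter_upwards [hP.eventually_ge_atTop 1] with j hj
      have : (P j : ℝ) ≠ 0 := by norm_cast; omega
      rw [div_self this]
    simpa using tendsto_descFactorial_div hP h1 d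
  have hnum := tendsto_finsetProd univ fun i _ => tendsto_descFactorial_div hP (hw i) (α i)
  have := hnum.div hden one_ne_zero
  rw [div_one] at this
  refine this.congr' ?_
  filter_upwards [hP.eventually_ge_atTop 1] with j hj
  have : (P j : ℝ) ≠ 0 := by norm_cast; omega
  simp only [Pi.div_apply, Finset.prod_div_distrib, Finset.prod_pow_eq_pow_sum, hα]
  field_simp

end Limits

/-! ### Binomial forms and Bernstein forms of their negative parts -/

/-- A binomial form `pos * y ^ posExp - neg * y ^ negExp`. -/
structure BinomialForm (ι : Type*) where
  pos : ℝ
  neg : ℝ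
  posExp : ι → ℕ
  negExp : ι → ℕ

namespace BinomialForm

variable {ι : Type*} [Fintype ι]

/-- The value of a binomial form. -/
def eval (g : BinomialForm ι) (y : ι → ℝ) : ℝ :=
  g.pos * ∏ i, y i ^ g.posExp i - g.neg * ∏ i, y i ^ g.negExp i

/-- The negative part of a binomial form. -/
def negPart (g : BinomialForm ι) (y : ι → ℝ) : ℝ := max 0 (-g.eval y)

/-- The common degree of the two terms of a homogeneous binomial form. -/
def degree (g : BinomialForm ι) : ℕ := ∑ i, g.posExp i

/-- A homogeneous binomial form with nonnegative coefficients that is nonnegative on `Y`. -/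
structure IsValid (g : BinomialForm ι) (Y : Set (ι → ℝ)) : Prop where
  pos_nonneg : 0 ≤ g.pos
  sum_negExp : ∑ i, g.negExp i = g.degree
  eval_nonneg : ∀ y ∈ Y, 0 ≤ g.eval y

theorem continuous_eval (g : BinomialForm ι) : Continuous g.eval := by
  unfold eval; fun_prop

theorem continuous_negPart (g : BinomialForm ι) : Continuous g.negPart :=
  continuous_const.max g.continuous_eval.neg

theorem negPart_nonneg (g : BinomialForm ι) (y : ι → ℝ) : 0 ≤ g.negPart y := le_max_left _ _

theorem negPart_mul_eval (g : BinomialForm ι) (y : ι → ℝ) :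
    g.negPart y * g.eval y = -(g.negPart y) ^ 2 := by
  unfold negPart
  rcases le_total 0 (g.eval y) with h | h
  · rw [max_eq_left (by linarith)]; ring
  · rw [max_eq_right (by linarith)]; ring

/-- The multinomial coefficient at `w`, for forms of degree `P`, of the product of `g` with the
Bernstein form of degree `P - g.degree` of its negative part. -/
noncomputable def bernsteinCoeff (g : BinomialForm ι) (P : ℕ) (w : ι → ℕ) : ℝ :=
  g.pos * ((∏ i, ((w i).descFactorial (g.posExp i) : ℝ)) / P.descFactorial g.degree *
      g.negPart fun i => ((w - g.posExp) i : ℝ) / ((P - g.degree : ℕ) : ℝ)) -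
    g.neg * ((∏ i, ((w i).descFactorial (g.negExp i) : ℝ)) / P.descFactorial g.degree *
      g.negPart fun i => ((w - g.negExp) i : ℝ) / ((P - g.degree : ℕ) : ℝ))

theorem sum_bernsteinCoeff [DecidableEq ι] {g : BinomialForm ι} {Y : Set (ι → ℝ)}
    (hg : g.IsValid Y) {P : ℕ} (hP : g.degree ≤ P) (y : ι → ℝ) :
    ∑ v ∈ piAntidiag univ (P - g.degree), Nat.multinomial univ v *
        g.negPart (fun i => (v i : ℝ) / ((P - g.degree : ℕ) : ℝ)) *
        (∏ i, y i ^ v i) * g.eval y =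
      ∑ w ∈ piAntidiag univ P, Nat.multinomial univ w * g.bernsteinCoeff P w *
        ∏ i, y i ^ w i := by
  have h1 := sum_multinomial_mul_monomial hP (α := g.posExp) rfl
    (fun v => g.negPart fun i => (v i : ℝ) / ((P - g.degree : ℕ) : ℝ)) y
  have h2 := sum_multinomial_mul_monomial hP hg.sum_negExp
    (fun v => g.negPart fun i => (v i : ℝ) / ((P - g.degree : ℕ) : ℝ)) y
  rw [← Finset.sum_mul, eval, mul_sub, mul_left_comm, h1, mul_left_comm, h2, Finset.mul_sum,
    Finset.mul_sum, ← Finset.sum_sub_distrib]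
  refine Finset.sum_congr rfl fun w _ => ?_
  unfold bernsteinCoeff
  ring

theorem tendsto_bernsteinCoeff {g : BinomialForm ι} {Y : Set (ι → ℝ)} (hg : g.IsValid Y)
    {P : ℕ → ℕ} (hP : Tendsto P atTop atTop) {w : ℕ → ι → ℕ} {u : ι → ℝ}
    (hw : ∀ i, Tendsto (fun j => (w j i : ℝ) / P j) atTop (𝓝 (u i))) :
    Tendsto (fun j => g.bernsteinCoeff (P j) (w j)) atTop (𝓝 (-(g.negPart u) ^ 2)) := by
  have hpt : ∀ α : ι → ℕ, Tendsto (fun j => g.negPart fun i =>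
      ((w j - α) i : ℝ) / ((P j - g.degree : ℕ) : ℝ)) atTop (𝓝 (g.negPart u)) := fun α =>
    (g.continuous_negPart.tendsto u).comp
      (tendsto_pi_nhds.2 fun i => tendsto_tsub_div_tsub hP (hw i) (α i) g.degree)
  have h1 := ((tendsto_prod_descFactorial_div hP hw (α := g.posExp) (d := g.degree) rfl).mul
    (hpt g.posExp)).const_mul g.pos
  have h2 := ((tendsto_prod_descFactorial_div hP hw hg.sum_negExp).mul
    (hpt g.negExp)).const_mul g.neg
  have := h1.sub h2
  have e : -(g.negPart u) ^ 2 = g.pos * ((∏ i, u i ^ g.posExp i) * g.negPart u) -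
      g.neg * ((∏ i, u i ^ g.negExp i) * g.negPart u) := by
    rw [← negPart_mul_eval, eval]; ring
  rw [e]
  exact this

end BinomialForm

/-! ### Pólya-type positivity of coefficients -/

section Polya

variable {ι : Type*} [Fintype ι] [DecidableEq ι]

/-- A Pólya type theorem: positivity on the simplex of the limit gives positivity of all
coefficients in high degree. -/
theorem exists_coeff_nonneg {Y : Set (ι → ℝ)} (c : ι → ℝ) (F : Finset (BinomialForm ι))
    (hF : ∀ g ∈ F, g.IsValid Y)
    (hpos : ∀ u ∈ stdSimplex ℝ ι, 0 < ∑ i, c i * u i + ∑ g ∈ F, (g.negPart u) ^ 2) :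
    ∃ p : ℕ, (∀ g ∈ F, g.degree ≤ p + 1) ∧ ∀ w ∈ piAntidiag (univ : Finset ι) (p + 1),
      0 ≤ ∑ i, c i * ((w i : ℝ) / ((p + 1 : ℕ) : ℝ)) - ∑ g ∈ F, g.bernsteinCoeff (p + 1) w := by
  by_contra! hcon
  set D := ∑ g ∈ F, g.degree with hD
  have hdeg : ∀ j, ∀ g ∈ F, g.degree ≤ j + D + 1 := fun j g hg => by
    have := Finset.single_le_sum (f := fun g : BinomialForm ι => g.degree)
      (fun _ _ => Nat.zero_le _) hg
    omega
  -- Taking `p = j + D` makes every degree bound hold, so each failure is a negative coefficient; a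
  -- limit point of the normalised exponents then contradicts `hpos`.
  choose w hw hneg using fun j => hcon (j + D) (hdeg j)
  have hmem : ∀ j, (fun i => (w j i : ℝ) / ((j + D + 1 : ℕ) : ℝ)) ∈ stdSimplex ℝ ι := by
    intro j
    refine ⟨fun i => by positivity, ?_⟩
    have h := (mem_piAntidiag.1 (hw j)).1
    rw [← Finset.sum_div, ← Nat.cast_sum, h, div_self (by positivity)]
  obtain ⟨u, hu, φ, hφ, hlim⟩ := (isCompact_stdSimplex ℝ ι).tendsto_subseq hmem
  have hP : Tendsto (fun j => φ j + D + 1) atTop atTop :=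
    tendsto_atTop_mono (fun j => by omega) hφ.tendsto_atTop
  have hlim' := tendsto_pi_nhds.1 hlim
  simp only [Function.comp_def] at hlim'
  have h1 : Tendsto (fun j => ∑ i, c i * ((w (φ j) i : ℝ) / ((φ j + D + 1 : ℕ) : ℝ)) -
      ∑ g ∈ F, g.bernsteinCoeff (φ j + D + 1) (w (φ j))) atTop
      (𝓝 (∑ i, c i * u i - ∑ g ∈ F, -(g.negPart u) ^ 2)) :=
    (tendsto_finsetSum _ fun i _ => (hlim' i).const_mul (c i)).sub
      (tendsto_finsetSum _ fun g hg =>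
        BinomialForm.tendsto_bernsteinCoeff (hF g hg) hP (w := fun j => w (φ j)) hlim')
  have h2 := le_of_tendsto h1 (Eventually.of_forall fun j => (hneg (φ j)).le)
  rw [Finset.sum_neg_distrib, sub_neg_eq_add] at h2
  exact absurd (hpos u hu) (not_lt.2 h2)

end Polya

/-! ### Integral separation -/

section Separation

variable {ι : Type*} [Fintype ι]

/-- A point outside a compact convex set is separated from it by an integral functional. -/
theorem exists_int_separation {K : Set (ι → ℝ)} (hK : IsCompact K) (hKc : Convex ℝ K)
    {z : ι → ℝ} (hz : z ∉ K) :
    ∃ (b : ι → ℤ) (ε : ℝ), 0 < ε ∧ ∀ k ∈ K, ∑ i, (b i : ℝ) * k i ≤ ∑ i, (b i : ℝ) * z i - ε := by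
  classical
  obtain ⟨f, t, hft, hfz⟩ := geometric_hahn_banach_closed_point hKc hK.isClosed hz
  set a : ι → ℝ := fun i => f (Pi.single i 1) with ha
  have hf : ∀ x : ι → ℝ, f x = ∑ i, a i * x i := by
    intro x
    conv_lhs => rw [pi_eq_sum_univ' x, map_sum]
    refine Finset.sum_congr rfl fun i _ => ?_
    rw [map_smul, smul_eq_mul, mul_comm]
  obtain ⟨R, hR⟩ := hK.exists_bound_of_continuousOn (f := fun k : ι → ℝ => ∑ i, |z i - k i|)
    (by fun_prop)
  -- Rounding `N * a` down costs at most `∑ |z i - k i| ≤ R`; as `N * (f z - t) > R + 1`, a gap of 1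
  -- survives.
  obtain ⟨N, hN⟩ := exists_nat_gt ((R + 1) / (f z - t))
  rw [div_lt_iff₀ (by linarith)] at hN
  refine ⟨fun i => ⌊N * a i⌋, 1, one_pos, fun k hk => ?_⟩
  have h1 : ∑ i, |z i - k i| ≤ R := (le_abs_self _).trans (hR k hk)
  have h2 : (N : ℝ) * (f z - t) ≤ N * (f z - f k) := by
    have := hft k hk
    gcongr
  have h3 : ∑ i, ((N * a i) * (z i - k i) - |z i - k i|) ≤
      ∑ i, (⌊N * a i⌋ : ℝ) * (z i - k i) := by
    refine Finset.sum_le_sum fun i _ => ?_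
    have e1 := Int.floor_le (N * a i)
    have e2 := Int.lt_floor_add_one (N * a i)
    have e3 : (N * a i - ⌊N * a i⌋) * (z i - k i) ≤ 1 * |z i - k i| :=
      (mul_le_mul_of_nonneg_left (le_abs_self _) (by linarith)).trans
        (mul_le_mul_of_nonneg_right (by linarith) (abs_nonneg _))
    linarith
  have h4 : ∑ i, (N * a i) * (z i - k i) = N * (f z - f k) := by
    rw [hf, hf, ← Finset.sum_sub_distrib, Finset.mul_sum]
    exact Finset.sum_congr rfl fun i _ => by ring
  rw [Finset.sum_sub_distrib, h4] at h3
  simp_rw [mul_sub, Finset.sum_sub_distrib] at h3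
  linarith

end Separation

/-! ### Binomial certificates and the final decomposition -/

section Certificates

variable {ℓ n : ℕ} {A : Matrix (Fin ℓ) (Fin n) ℝ} {X : Set (Fin n → ℝ)}

/-- The map `x ↦ exp (A x)`. -/
noncomputable def expMap (A : Matrix (Fin ℓ) (Fin n) ℝ) (x : Fin n → ℝ) : Fin ℓ → ℝ :=
  fun i => Real.exp (A.mulVec x i)

theorem continuous_expMap (A : Matrix (Fin ℓ) (Fin n) ℝ) : Continuous (expMap A) := by
  unfold expMap; fun_prop

/-- The exponent vector of degree `∑ i, m i + k` obtained from `m` by adding `k` at `i₀`. -/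
def addAt {ι : Type*} [DecidableEq ι] (m : ι → ℕ) (i₀ : ι) (k : ℕ) : ι → ℕ :=
  m + Pi.single i₀ k

theorem sum_addAt {ι : Type*} [Fintype ι] [DecidableEq ι] (m : ι → ℕ) (i₀ : ι) (k : ℕ) :
    ∑ i, addAt m i₀ k i = ∑ i, m i + k := by
  simp [addAt, Finset.sum_add_distrib]

theorem prod_exp_pow_addAt {ι : Type*} [Fintype ι] [DecidableEq ι] (m : ι → ℕ) (i₀ : ι) (k : ℕ)
    (q : ι → ℝ) :
    ∏ i, Real.exp (q i) ^ addAt m i₀ k i = Real.exp (∑ i, m i * q i + k * q i₀) := by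
  have h : ∏ i, Real.exp (q i) ^ (Pi.single i₀ k : ι → ℕ) i = Real.exp (k * q i₀) := by
    rw [Finset.prod_eq_single i₀, Pi.single_eq_same, Real.exp_nat_mul]
    · intro j _ hj; simp [Pi.single_eq_of_ne hj]
    · simp
  simp_rw [addAt, Pi.add_apply, pow_add, Finset.prod_mul_distrib]
  rw [h, Real.exp_add, Real.exp_sum]
  simp_rw [Real.exp_nat_mul]

/-- The ratio `y i / y j` is bounded on `Y`, so `C * y j - y i` is valid, and at `u` it equals `-u
i`. -/
theorem exists_isValid_eval_neg_of_eq_zero (hX : IsCompact X) {u : Fin ℓ → ℝ} {i j : Fin ℓ}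
    (hi : 0 < u i) (hj : u j = 0) :
    ∃ g : BinomialForm (Fin ℓ), g.IsValid (expMap A '' X) ∧ g.eval u < 0 := by
  obtain ⟨C, hC⟩ := hX.exists_bound_of_continuousOn
    (f := fun x => Real.exp (A.mulVec x i - A.mulVec x j)) (by fun_prop)
  have hsingle : ∀ (y : Fin ℓ → ℝ) (k : Fin ℓ),
      ∏ a, y a ^ (Pi.single k 1 : Fin ℓ → ℕ) a = y k := by
    intro y k
    rw [Finset.prod_eq_single k] <;> simp +contextual
  -- `C` may be negative when `X` is empty, hence `|C|`.
  refine ⟨⟨|C|, 1, Pi.single j 1, Pi.single i 1⟩, ⟨abs_nonneg C, ?_, ?_⟩, ?_⟩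
  · simp [BinomialForm.degree]
  · rintro _ ⟨x, hx, rfl⟩
    simp only [BinomialForm.eval, hsingle, expMap]
    have h := (le_abs_self _).trans ((hC x hx).trans (le_abs_self C))
    rw [Real.exp_sub, div_le_iff₀ (Real.exp_pos _)] at h
    linarith
  · simp only [BinomialForm.eval, hsingle, hj]
    linarith

/-- Were the log-coordinates of `u` relative to `i₀` attained on `X`, `u` would be a positive
multiple of a point of `Y`, against the sign of `c·u`. Exponentiating an integral separating
inequality gives the binomial. -/
theorem exists_isValid_eval_neg_of_pos (hX : IsCompact X) (hXc : Convex ℝ X) {c : Fin ℓ → ℝ}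
    (hc : ∀ x ∈ X, 0 < ∑ i, c i * expMap A x i) {u : Fin ℓ → ℝ} (hu : ∀ i, 0 < u i)
    (hcu : ∑ i, c i * u i ≤ 0) (i₀ : Fin ℓ) :
    ∃ g : BinomialForm (Fin ℓ), g.IsValid (expMap A '' X) ∧ g.eval u < 0 := by
  set L : (Fin n → ℝ) →ₗ[ℝ] (Fin ℓ → ℝ) := LinearMap.pi fun i =>
    LinearMap.proj i ∘ₗ A.mulVecLin - LinearMap.proj i₀ ∘ₗ A.mulVecLin with hL
  have hLx : ∀ x i, L x i = A.mulVec x i - A.mulVec x i₀ := fun x i => by simp [hL]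
  set z : Fin ℓ → ℝ := fun i => Real.log (u i) - Real.log (u i₀) with hz
  have hzK : z ∉ L '' X := by
    rintro ⟨x, hx, hxz⟩
    have h1 : ∀ i, u i = Real.exp (Real.log (u i₀) - A.mulVec x i₀) * expMap A x i := by
      intro i
      have h2 := congrFun hxz i
      rw [hLx, hz] at h2
      rw [expMap, ← Real.exp_add, ← Real.exp_log (hu i)]
      congr 1
      simp only at h2
      linarith
    have h3 : ∑ i, c i * u i =
        Real.exp (Real.log (u i₀) - A.mulVec x i₀) * ∑ i, c i * expMap A x i := by
      rw [Finset.mul_sum]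
      exact Finset.sum_congr rfl fun i _ => by rw [h1 i]; ring
    have h4 := mul_pos (Real.exp_pos (Real.log (u i₀) - A.mulVec x i₀)) (hc x hx)
    linarith
  obtain ⟨b, ε, hε, hb⟩ := exists_int_separation
    (hX.image (LinearMap.continuous_of_finiteDimensional L)) (hXc.linear_image L) hzK
  set bp : Fin ℓ → ℕ := fun i => (b i).toNat with hbp
  set bm : Fin ℓ → ℕ := fun i => (-b i).toNat with hbm
  have hbb : ∀ i, (b i : ℝ) = bp i - bm i := fun i => by
    have : b i = (bp i : ℤ) - bm i := by simp only [hbp, hbm]; omega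
    exact_mod_cast congrArg (Int.cast : ℤ → ℝ) this
  have hdiff : ∀ q : Fin ℓ → ℝ,
      (∑ i, bp i * q i + (∑ i, bm i : ℕ) * q i₀) - (∑ i, bm i * q i + (∑ i, bp i : ℕ) * q i₀) =
        ∑ i, (b i : ℝ) * (q i - q i₀) := by
    intro q
    simp_rw [hbb, mul_sub, sub_mul, Finset.sum_sub_distrib, ← Finset.sum_mul]
    push_cast
    ring
  -- Moving `bm` across the inequality makes the exponents natural; padding at `i₀` equalises the
  -- degrees. The leading coefficient is the separating bound, and `ε` makes the value at `u`
  -- strictly negative.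
  refine ⟨⟨Real.exp (∑ i, (b i : ℝ) * z i - ε), 1, addAt bm i₀ (∑ i, bp i),
    addAt bp i₀ (∑ i, bm i)⟩, ⟨(Real.exp_pos _).le, ?_, ?_⟩, ?_⟩
  · simp only [BinomialForm.degree, sum_addAt]
    omega
  · rintro _ ⟨x, hx, rfl⟩
    simp only [BinomialForm.eval, expMap]
    rw [prod_exp_pow_addAt, prod_exp_pow_addAt, ← Real.exp_add, one_mul, sub_nonneg,
      Real.exp_le_exp]
    have h1 := hb _ ⟨x, hx, rfl⟩
    simp_rw [hLx] at h1
    have h2 := hdiff (A.mulVec x)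
    linarith
  · have hul : u = fun i => Real.exp (Real.log (u i)) := by
      ext i; rw [Real.exp_log (hu i)]
    simp only [BinomialForm.eval]
    rw [hul, prod_exp_pow_addAt, prod_exp_pow_addAt, ← Real.exp_add, one_mul, sub_neg,
      Real.exp_lt_exp]
    have h2 := hdiff fun i => Real.log (u i)
    simp only [hz]
    linarith

theorem exists_isValid_eval_neg (hX : IsCompact X) (hXc : Convex ℝ X) {c : Fin ℓ → ℝ}
    (hc : ∀ x ∈ X, 0 < ∑ i, c i * expMap A x i) {u : Fin ℓ → ℝ} (hu : u ∈ stdSimplex ℝ (Fin ℓ))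
    (hcu : ∑ i, c i * u i ≤ 0) :
    ∃ g : BinomialForm (Fin ℓ), g.IsValid (expMap A '' X) ∧ g.eval u < 0 := by
  obtain ⟨i, -, hi⟩ : ∃ i ∈ univ, 0 < u i :=
    Finset.exists_lt_of_sum_lt (by simp [hu.2])
  by_cases hz : ∃ j, u j = 0
  · obtain ⟨j, hj⟩ := hz
    exact exists_isValid_eval_neg_of_eq_zero hX hi hj
  · push Not at hz
    exact exists_isValid_eval_neg_of_pos hX hXc hc (fun i => (hu.1 i).lt_of_ne' (hz i)) hcu i

theorem exists_isValid_add_sq_pos (hX : IsCompact X) (hXc : Convex ℝ X) {c : Fin ℓ → ℝ}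
    (hc : ∀ x ∈ X, 0 < ∑ i, c i * expMap A x i) {u : Fin ℓ → ℝ}
    (hu : u ∈ stdSimplex ℝ (Fin ℓ)) :
    ∃ g : BinomialForm (Fin ℓ), g.IsValid (expMap A '' X) ∧
      0 < ∑ i, c i * u i + (g.negPart u) ^ 2 := by
  rcases lt_or_ge 0 (∑ i, c i * u i) with hcu | hcu
  · refine ⟨⟨0, 0, 0, 0⟩, ⟨le_rfl, rfl, fun y _ => by simp [BinomialForm.eval]⟩, ?_⟩
    positivity
  · obtain ⟨g, hg, hgu⟩ := exists_isValid_eval_neg hX hXc hc hu hcu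
    -- With `s = c·u ≤ 0`, this scaling gives negative part `1 - s` at `u`, and `s + (1 - s)² ≥ 1`.
    set t : ℝ := (1 - ∑ i, c i * u i) / (-g.eval u) with ht
    have ht0 : 0 ≤ t := div_nonneg (by linarith) (by linarith)
    have hscale : ∀ y, BinomialForm.eval ⟨t * g.pos, t * g.neg, g.posExp, g.negExp⟩ y =
        t * g.eval y := fun y => by simp only [BinomialForm.eval]; ring
    refine ⟨⟨t * g.pos, t * g.neg, g.posExp, g.negExp⟩,
      ⟨mul_nonneg ht0 hg.pos_nonneg, hg.sum_negExp, fun y hy => ?_⟩, ?_⟩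
    · rw [hscale]
      exact mul_nonneg ht0 (hg.eval_nonneg y hy)
    · have h1 : t * g.eval u = -(1 - ∑ i, c i * u i) := by
        rw [ht]; field_simp [hgu.ne]
      rw [BinomialForm.negPart, hscale, h1, neg_neg, max_eq_right (by linarith)]
      nlinarith

theorem exists_finset_isValid (hX : IsCompact X) (hXc : Convex ℝ X) {c : Fin ℓ → ℝ}
    (hc : ∀ x ∈ X, 0 < ∑ i, c i * expMap A x i) :
    ∃ F : Finset (BinomialForm (Fin ℓ)), (∀ g ∈ F, g.IsValid (expMap A '' X)) ∧
      ∀ u ∈ stdSimplex ℝ (Fin ℓ), 0 < ∑ i, c i * u i + ∑ g ∈ F, (g.negPart u) ^ 2 := by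
  classical
  have : Nonempty (BinomialForm (Fin ℓ)) := ⟨⟨0, 0, 0, 0⟩⟩
  choose! G hG hGpos using fun u (hu : u ∈ stdSimplex ℝ (Fin ℓ)) =>
    exists_isValid_add_sq_pos hX hXc hc hu
  obtain ⟨T, hT, hcover⟩ := (isCompact_stdSimplex ℝ (Fin ℓ)).elim_nhds_subcover
    (fun v => {u | 0 < ∑ i, c i * u i + ((G v).negPart u) ^ 2}) fun v hv =>
      (isOpen_lt continuous_const (Continuous.add (by fun_prop)
        ((G v).continuous_negPart.pow 2))).mem_nhds (hGpos v hv)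
  refine ⟨T.image G, fun g hg => ?_, fun u hu => ?_⟩
  · obtain ⟨v, hv, rfl⟩ := Finset.mem_image.1 hg
    exact hG v (hT v hv)
  · obtain ⟨v, hv, huv⟩ := Set.mem_iUnion₂.1 (hcover hu)
    have h := Finset.single_le_sum (f := fun g : BinomialForm (Fin ℓ) => (g.negPart u) ^ 2)
      (fun _ _ => sq_nonneg _) (Finset.mem_image_of_mem G hv)
    have huv' : 0 < ∑ i, c i * u i + ((G v).negPart u) ^ 2 := huv
    linarith

theorem exists_pow_mul_mem_SAGE (hX : IsCompact X) (hXc : Convex ℝ X) {c : Fin ℓ → ℝ}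
    (hc : ∀ x ∈ X, 0 < Sig c A x) :
    ∃ p : ℕ, expSum A ^ p * Sig c A ∈ SAGE (E (p + 1) A) X := by
  obtain ⟨F, hF, hpos⟩ := exists_finset_isValid hX hXc (A := A) (c := c) hc
  obtain ⟨p, hdeg, hcoeff⟩ := exists_coeff_nonneg c F hF hpos
  refine ⟨p, ?_⟩
  -- The first sum consists of monomial multiples of valid binomials, the second of monomials with
  -- coefficients made nonnegative by `hcoeff`.
  have key : expSum A ^ p * Sig c A =
      (∑ g ∈ F, ∑ v ∈ piAntidiag univ (p + 1 - g.degree), fun x =>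
        Nat.multinomial univ v * g.negPart (fun i => (v i : ℝ) / ((p + 1 - g.degree : ℕ) : ℝ)) *
          (∏ i, expMap A x i ^ v i) * g.eval (expMap A x)) +
      ∑ w ∈ piAntidiag univ (p + 1), fun x => Nat.multinomial univ w *
        (∑ i, c i * ((w i : ℝ) / ((p + 1 : ℕ) : ℝ)) - ∑ g ∈ F, g.bernsteinCoeff (p + 1) w) *
          ∏ i, expMap A x i ^ w i := by
    ext x
    have h1 := sum_pow_mul_linear p c (expMap A x)
    have h2 := Finset.sum_congr rfl fun g hg =>
      BinomialForm.sum_bernsteinCoeff (hF g hg) (hdeg g hg) (expMap A x)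
    simp only [Pi.mul_apply, Pi.pow_apply, Pi.add_apply, Finset.sum_apply]
    rw [h2, Finset.sum_comm, ← Finset.sum_add_distrib]
    refine h1.trans (Finset.sum_congr rfl fun w _ => ?_)
    rw [← Finset.sum_mul, ← Finset.mul_sum]
    ring
  rw [key]
  refine add_mem_SAGE (sum_mem_SAGE F fun g hg => sum_mem_SAGE _ fun v hv => ?_)
    (sum_mem_SAGE _ fun w hw => monomial_mem_SAGE (mem_piAntidiag.1 hw).1.le
      (mul_nonneg (Nat.cast_nonneg _) (hcoeff w hw)))
  set H : ℝ := Nat.multinomial univ v *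
    g.negPart (fun i => (v i : ℝ) / ((p + 1 - g.degree : ℕ) : ℝ))
  have hH : 0 ≤ H := mul_nonneg (Nat.cast_nonneg _) (g.negPart_nonneg _)
  have hd := hdeg g hg
  have hv' : ∑ i, v i = p + 1 - g.degree := (mem_piAntidiag.1 hv).1
  have heq : ∀ x, H * (∏ i, expMap A x i ^ v i) * g.eval (expMap A x) =
      (H * g.pos) * ∏ i, Real.exp (A.mulVec x i) ^ (v + g.posExp) i -
        (H * g.neg) * ∏ i, Real.exp (A.mulVec x i) ^ (v + g.negExp) i := by
    intro x
    simp only [BinomialForm.eval, expMap, Pi.add_apply, pow_add, Finset.prod_mul_distrib]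
    ring
  have hle : ∀ α : Fin ℓ → ℕ, ∑ i, α i = g.degree → ∑ i, (v + α) i ≤ p + 1 := by
    intro α hα
    simp only [Pi.add_apply, Finset.sum_add_distrib, hα]
    omega
  simp_rw [heq]
  refine monomial_binomial_mem_SAGE (hle _ rfl) (hle _ (hF g hg).sum_negExp)
    (mul_nonneg hH (hF g hg).pos_nonneg) fun x hx => ?_
  rw [← heq]
  exact mul_nonneg (mul_nonneg hH (Finset.prod_nonneg fun i _ =>
    pow_nonneg (Real.exp_pos _).le _)) ((hF g hg).eval_nonneg _ ⟨x, hx, rfl⟩)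

end Certificates

end SageHierarchy

theorem mainTheorem1 {ℓ n : ℕ} (A : Matrix (Fin ℓ) (Fin n) ℚ) (X : Set (Fin n → ℝ))
    (hX_compact : IsCompact X) (hX_convex : Convex ℝ X) :
    (∀ c : Fin ℓ → ℝ,
      (∀ x ∈ X, 0 < SageHierarchy.Sig c (A.map (fun q : ℚ => (q : ℝ))) x) →
      ∃ p : ℕ,
        SageHierarchy.expSum (A.map (fun q : ℚ => (q : ℝ))) ^ p *
            SageHierarchy.Sig c (A.map (fun q : ℚ => (q : ℝ))) ∈
          SageHierarchy.SAGE (SageHierarchy.E (p + 1) (A.map (fun q : ℚ => (q : ℝ)))) X) ∧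
    {c : Fin ℓ → ℝ | ∀ x ∈ X, 0 < SageHierarchy.Sig c (A.map (fun q : ℚ => (q : ℝ))) x} ⊆
      ⋃ p : ℕ, SageHierarchy.CSAGE p (A.map (fun q : ℚ => (q : ℝ))) X :=
  ⟨fun _ hc => SageHierarchy.exists_pow_mul_mem_SAGE hX_compact hX_convex hc,
    fun _ hc => Set.mem_iUnion.2
      (SageHierarchy.exists_pow_mul_mem_SAGE hX_compact hX_convex hc)⟩
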